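/- Let $n\ge 0$ be an integer and consider the $n$-peakon Hamiltonian system of the Camassa–Holm equation, $\dot q_i=\partial H/\partial p_i$, $\dot p_i=-\partial H/\partial q_i$ ($i=1,\dots,n$), $H(q,p)=\frac12\sum_{i,j=1}^n p_ip_je^{-|q_i-q_j|}$. Put $H_0=\sum_{i=1}^n p_i$, $H_1=H$, $$P_0=\sum_{i,j=1}^np_ie^{-|q_i-q_j|}\,\partial_{p_i}\wedge\partial_{q_j}-\sum_{i<j}\operatorname{sign}(q_i-q_j)p_ip_je^{-|q_i-q_j|}\,\partial_{p_i}\wedge\partial_{p_j}+\sum_{i<j}\operatorname{sign}(q_i-q_j)(e^{-|q_i-q_j|}-1)\,\partial_{q_i}\wedge\partial_{q_j},$$ $P_1=\sum_{i=1}^n\partial_{p_i}\wedge\partial_{q_i}$, where a bi-vector $P$ is regarded as the map $\alpha\mapsto P(\alpha,\cdot)$ from one-forms to vector fields (with $v\wedge w$ sending $\alpha$ to $\frac12(\alpha(v)w-\alpha(w)v)$), and let $S=P_1^{-1}\circ P_0$ be the recursion operator on one-forms. For $s\ge 0$ let $\mathcal I^n_s$ be the set of multi-indices $I=(i_0,\dots,i_s)$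 with $1\le i_0\le i_1\le\dots\le i_s\le n$; let $p_I=p_{i_0}\cdots p_{i_s}$ and let $I!$ be the product of the factorials of the multiplicities of the distinct values among $i_0,\dots,i_s$. Let $\mathcal P_s$ be the set of maps $\rho\colon\{1,\dots,s\}\to\{0,\dots,s-1\}$ with $\rho(j)<j$ for all $j$ (for $s=0$ it consists of the empty map). For $\rho\in\mathcal P_s$ let $s_\rho$ be the number of $j\in\{1,\dots,s-1\}$ with $\rho^{-1}(j)\neq\emptyset$, and let $c_\rho=0$ if $|\rho^{-1}(0)|>1$ or $|\rho^{-1}(j)|>2$ for some $j\in\{1,\dots,s-1\}$, and $c_\rho=2^{s_\rho}$ otherwise. **Theorem.** In the region $q_1>\dots>q_n$ (with $p\in\mathbb R^n$ arbitrary) there are functions $H_0,H_1,H_2,\dots$, where $H_0$ and $H_1$ are as above, such that $dH_{i+1}=S^i(dH_1)$ for all $i\ge0$ and, to fix the constants of integration, $H_i(q,0)=0$ for all $i\ge 0$. Any such functions $H_s$, $s\ge 0$, are first integrals of the Hamiltonian system, that is, constant along its solutions in this region, and are given there by $$H_s(q,p)=\sum_{I\in\mathcal I_s^n}\frac1{I!}\,p_I\left(\sum_{\rho\in\mathcal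 P_s}c_\rho\,e^{-\sum_{j=1}^s(q_{i_{\rho(j)}}-q_{i_j})}\right).$$ Moreover $\sum_{\rho\in\mathcal P_s}c_\rho=s!$ for every $s\ge0$. -/

import Mathlib

noncomputable section

namespace Peakon

/-- The phase space of `n` peakons: a point is a pair `(q, p)` of positions and momenta. -/
abbrev Phase (n : ℕ) : Type := (Fin n → ℝ) × (Fin n → ℝ)

/-- Covectors (values of one-forms at a point) on the phase space. -/
abbrev Covector (n : ℕ) : Type := Phase n →L[ℝ] ℝ

/-- The coordinate vector field `∂/∂q_i`. -/
def dq {n : ℕ} (i : Fin n) : Phase n := (Pi.single i 1, 0)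

/-- The coordinate vector field `∂/∂p_i`. -/
def dp {n : ℕ} (i : Fin n) : Phase n := (0, Pi.single i 1)

/-- The momentum `H_0 = ∑ p_i`. -/
def momentum {n : ℕ} (x : Phase n) : ℝ := ∑ i, x.2 i

/-- The energy `H_1 = (1/2) ∑ p_i p_j exp (-|q_i - q_j|)`, the Hamiltonian of the `n`-peakon
system. -/
def energy {n : ℕ} (x : Phase n) : ℝ :=
  (1 / 2) * ∑ i, ∑ j, x.2 i * x.2 j * Real.exp (-|x.1 i - x.1 j|)

/-- The right-hand side of Hamilton's equations `q_i' = ∂H/∂p_i`, `p_i' = -∂H/∂q_i` with `H` the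
energy. -/
def hamiltonField {n : ℕ} (x : Phase n) : Phase n :=
  (fun i => fderiv ℝ energy x (dp i), fun i => -fderiv ℝ energy x (dq i))

/-- The region `q_1 > ⋯ > q_n` of the phase space (`p` is arbitrary). -/
def region (n : ℕ) : Set (Phase n) := {x | ∀ i j : Fin n, i < j → x.1 j < x.1 i}

/-- The elementary bi-vector `v ∧ w`, seen as the map `α ↦ (v ∧ w)(α, ·)` from covectors to
vectors, with the normalization `(v ∧ w)(α, β) = (α(v) β(w) - α(w) β(v)) / 2`. -/
def wedge {n : ℕ} (v w : Phase n) : Covector n →ₗ[ℝ] Phase n where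
  toFun α := (1 / 2 : ℝ) • (α v • w - α w • v)
  map_add' α β := by
    simp only [add_apply]
    module
  map_smul' c α := by
    simp only [smul_apply, smul_eq_mul, RingHom.id_apply]
    module

/-- The bi-vector `P_0` at the point `x = (q, p)`, as a map from covectors to vectors. -/
def P0 {n : ℕ} (x : Phase n) : Covector n →ₗ[ℝ] Phase n :=
  (∑ i, ∑ j, (x.2 i * Real.exp (-|x.1 i - x.1 j|)) • wedge (dp i) (dq j))
  - (∑ i, ∑ j, if i < j then
      (Real.sign (x.1 i - x.1 j) * x.2 i * x.2 j * Real.exp (-|x.1 i - x.1 j|)) •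
        wedge (dp i) (dp j) else 0)
  + ∑ i, ∑ j, if i < j then
      (Real.sign (x.1 i - x.1 j) * (Real.exp (-|x.1 i - x.1 j|) - 1)) •
        wedge (dq i) (dq j) else 0

/-- The canonical bi-vector `P_1 = ∑ ∂/∂p_i ∧ ∂/∂q_i`, as a map from covectors to vectors. -/
def P1 (n : ℕ) : Covector n →ₗ[ℝ] Phase n := ∑ i, wedge (dp i) (dq i)

theorem P1_fst {n : ℕ} (α : Covector n) (i : Fin n) : (P1 n α).1 i = (1 / 2) * α (dp i) := by
  simp [P1, wedge, dp, dq, Prod.fst_sum, Finset.sum_apply, Pi.single_apply]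

theorem P1_snd {n : ℕ} (α : Covector n) (i : Fin n) : (P1 n α).2 i = -((1 / 2) * α (dq i)) := by
  simp [P1, wedge, dp, dq, Prod.snd_sum, Finset.sum_apply, Pi.single_apply]

theorem phase_eq_sum {n : ℕ} (v : Phase n) :
    v = (∑ i, v.1 i • dq i) + ∑ i, v.2 i • dp i := by
  ext i <;> simp [dp, dq, Prod.fst_sum, Prod.snd_sum, Finset.sum_apply, Pi.single_apply]

/-- `P_1` is non-degenerate. -/
theorem P1_bijective (n : ℕ) : Function.Bijective (P1 n) := by
  constructor
  · rw [injective_iff_map_eq_zero]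
    intro α h
    have h1 : ∀ i, α (dp i) = 0 := fun i => by
      have := P1_fst α i
      rw [h] at this
      simpa using this.symm
    have h2 : ∀ i, α (dq i) = 0 := fun i => by
      have := P1_snd α i
      rw [h] at this
      simpa using this.symm
    refine ContinuousLinearMap.ext fun v => ?_
    rw [phase_eq_sum v]
    simp only [map_add, map_sum, map_smul, h1, h2]
    simp
  · intro v
    refine ⟨(∑ i, (2 * v.1 i) • (ContinuousLinearMap.proj i).comp
          (ContinuousLinearMap.snd ℝ (Fin n → ℝ) (Fin n → ℝ)))
        - ∑ i, (2 * v.2 i) • (ContinuousLinearMap.proj i).comp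
          (ContinuousLinearMap.fst ℝ (Fin n → ℝ) (Fin n → ℝ)), ?_⟩
    refine Prod.ext (funext fun i => ?_) (funext fun i => ?_)
    · rw [P1_fst]
      simp [dp, Pi.single_apply]
    · rw [P1_snd]
      simp [dq, Pi.single_apply]

/-- The recursion operator `S = P_1⁻¹ ∘ P_0` on covectors at the point `x`. -/
def recursionOp {n : ℕ} (x : Phase n) : Module.End ℝ (Covector n) :=
  (LinearEquiv.ofBijective (P1 n) (P1_bijective n)).symm.toLinearMap ∘ₗ P0 x

/-- `H_0, H_1, H_2, …` are functions on the region `q_1 > ⋯ > q_n` constructed by the recursion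
operator: `H_0` is the momentum, `H_1` the energy, and `dH_{i+1} = S^i (dH_1)` for all `i`.
The constant of integration, which the differential does not determine, is fixed
by `H_i(q, 0) = 0`. -/
structure IsRecursionSequence (n : ℕ) (H : ℕ → Phase n → ℝ) : Prop where
  zero : ∀ x ∈ region n, H 0 x = momentum x
  one : ∀ x ∈ region n, H 1 x = energy x
  hasFDerivAt : ∀ i, ∀ x ∈ region n,
    HasFDerivAt (H (i + 1)) ((recursionOp x ^ i) (fderiv ℝ energy x)) x
  normalized : ∀ i, ∀ q : Fin n → ℝ, (q, 0) ∈ region n → H i (q, 0) = 0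

/-- `F` is constant along every solution of Hamilton's equations that stays in the
region `q_1 > ⋯ > q_n`. -/
def IsFirstIntegral {n : ℕ} (F : Phase n → ℝ) : Prop :=
  ∀ (a b : ℝ) (γ : ℝ → Phase n),
    (∀ t ∈ Set.Ioo a b, γ t ∈ region n ∧ HasDerivAt γ (hamiltonField (γ t)) t) →
    ∀ t₁ ∈ Set.Ioo a b, ∀ t₂ ∈ Set.Ioo a b, F (γ t₁) = F (γ t₂)

/-- Multi-indices `i_0 ≤ i_1 ≤ ⋯ ≤ i_s` with entries in an `n`-element set. -/
def multiIndices (n s : ℕ) : Finset (Fin (s + 1) → Fin n) :=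
  open Classical in Finset.univ.filter fun I => Monotone I

/-- `I!`, the product of the factorials of the multiplicities of the values of `I`. -/
def multiFactorial {n s : ℕ} (I : Fin (s + 1) → Fin n) : ℕ :=
  ∏ v : Fin n, Nat.factorial (Finset.univ.filter fun j => I j = v).card

/-- The maps `ρ : {1, …, s} → {0, …, s - 1}` with `ρ(j) < j`. The argument `k : Fin s` stands
for `j = k + 1`. -/
def rhoMaps (s : ℕ) : Finset (Fin s → Fin s) :=
  Finset.univ.filter fun ρ => ∀ k, (ρ k).castSucc < k.succ

/-- The size of the preimage `ρ⁻¹(j)`. -/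
def fiberCard {s : ℕ} (ρ : Fin s → Fin s) (j : Fin s) : ℕ :=
  (Finset.univ.filter fun k => ρ k = j).card

/-- `s_ρ`, the number of `j ∈ {1, …, s - 1}` that belong to the image of `ρ`. -/
def sRho {s : ℕ} (ρ : Fin s → Fin s) : ℕ :=
  (Finset.univ.filter fun j : Fin s => (j : ℕ) ≠ 0 ∧ 1 ≤ fiberCard ρ j).card

/-- The coefficient `c_ρ`. -/
def cRho {s : ℕ} (ρ : Fin s → Fin s) : ℕ :=
  if (∃ j : Fin s, (j : ℕ) = 0 ∧ 1 < fiberCard ρ j) ∨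
      (∃ j : Fin s, (j : ℕ) ≠ 0 ∧ 2 < fiberCard ρ j)
  then 0 else 2 ^ sRho ρ

/-- The explicit formula
`∑_I (1 / I!) p_I ∑_ρ c_ρ exp (-∑_{j=1}^s (q_{i_{ρ(j)}} - q_{i_j}))`. -/
def explicitIntegral {n : ℕ} (s : ℕ) (x : Phase n) : ℝ :=
  ∑ I ∈ multiIndices n s, (1 / (multiFactorial I : ℝ)) * (∏ j, x.2 (I j)) *
    ∑ ρ ∈ rhoMaps s, (cRho ρ : ℝ) *
      Real.exp (-∑ k : Fin s, (x.1 (I (ρ k).castSucc) - x.1 (I k.succ)))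

end Peakon

end

/-!
In the region `q_1 > ⋯ > q_n` put `e_ij = exp (-|q_i - q_j| / 2)` and let `L = E D` be the Lax
matrix, where `E = (e_ij)` and `D = diag (p_1, …, p_n)`. The integrals are the normalized traces
`F_s = tr L ^ (s + 1) / (s + 1)`, for which `F_0` is the momentum and `F_1` the energy.

*Recursion.* The differential of `F_s` has the components `∂F_s/∂p_i = (L ^ s E)_ii` and
`∂F_s/∂q_i = ∑_j sign (i - j) e_ij N_ij`, where `N = D L ^ s` is symmetric. Both sides of
`dF_{s+1} = S (dF_s)` can be written in terms of `N`, linearly, and after symmetrization in the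
two indices of `N` the relation becomes two identities between the values of the kernel at three
points (`halfExp_identity_p`, `halfExp_identity_q`), which hold because the kernel is
multiplicative along increasing indices. This is `recursionOp_traceDeriv`. As the region is
convex, the differentials and the normalization at `p = 0` determine the functions, so every
recursion sequence consists of the `F_s` (`IsRecursionSequence.eq_traceIntegral`).

*Involution.* Since `P_0` and `P_1` are skew-symmetric, powers of `S` can be moved from one side
of the pairing defined by `P_1` to the other, so that all `dF_s = S ^ s (dF_0)` are in involution
(`recursionOp_pow_involution`). In particular `F_s` commutes with the Hamiltonian `F_1`.

*Explicit formula.* The trace `tr L ^ (s + 1)` is a sum over closed walks of length `s + 1`.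
Grouping the walks by their sorted index tuples `I` leaves, for each `I`, the sum over all orders
in which a closed walk can visit the `s + 1` points `I_0 ≤ ⋯ ≤ I_s`, and up to rotation the walk
starts at `I_0`. Such a walk is built by inserting the points one after another: the point `t` is
inserted into a step of the walk, and the larger endpoint `i` of this step, its slot, is replaced
by two slots `t`. Declaring `t` a child of `i` gives an increasing tree, that is, a map `ρ`; the
node `0` has one slot, the other nodes have two, and `c_ρ` counts the ways to distribute the
children of the nodes to their slots (`cRho_eq_prod`). Hence walks and weighted trees have the
same distribution of free slots (`sum_cRho_mul_freeSlots`). The weights of a walk and of a tree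
are the same function of the free slots (`walkWeight_exp`, `sum_sub_eq_of_cRho_ne_zero`), which
gives the formula; counting without weights gives `∑ c_ρ = s!`.
-/

noncomputable section

namespace Peakon

open Matrix

/-! ### The recursion operator in coordinates -/

/-- The skew-symmetric bi-vectors at a point, as maps from covectors to vectors. -/
def skewMaps (n : ℕ) : Submodule ℝ (Covector n →ₗ[ℝ] Phase n) where
  carrier := {A | ∀ α β : Covector n, β (A α) = -α (A β)}
  add_mem' {A B} hA hB α β := by
    rw [LinearMap.add_apply, LinearMap.add_apply, map_add, map_add, hA α β, hB α β, neg_add]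
  zero_mem' α β := by simp
  smul_mem' c A hA α β := by
    rw [LinearMap.smul_apply, LinearMap.smul_apply, map_smul, map_smul, hA α β, smul_neg]

theorem wedge_mem_skewMaps {n : ℕ} (v w : Phase n) : wedge v w ∈ skewMaps n := fun α β => by
  simp only [wedge, LinearMap.coe_mk, AddHom.coe_mk, map_smul, map_sub, smul_eq_mul]
  ring

theorem P1_skew {n : ℕ} (α β : Covector n) : β (P1 n α) = -α (P1 n β) :=
  (sum_mem fun _ _ => wedge_mem_skewMaps _ _ : P1 n ∈ skewMaps n) α β

theorem P0_mem_skewMaps {n : ℕ} (x : Phase n) : P0 x ∈ skewMaps n := by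
  refine add_mem (sub_mem ?_ ?_) ?_ <;> refine sum_mem fun i _ => sum_mem fun j _ => ?_
  · exact (skewMaps n).smul_mem _ (wedge_mem_skewMaps _ _)
  · split_ifs
    exacts [(skewMaps n).smul_mem _ (wedge_mem_skewMaps _ _), zero_mem _]
  · split_ifs
    exacts [(skewMaps n).smul_mem _ (wedge_mem_skewMaps _ _), zero_mem _]

theorem P0_skew {n : ℕ} (x : Phase n) (α β : Covector n) : β (P0 x α) = -α (P0 x β) :=
  P0_mem_skewMaps x α β

theorem P1_recursionOp {n : ℕ} (x : Phase n) (α : Covector n) :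
    P1 n (recursionOp x α) = P0 x α :=
  (LinearEquiv.ofBijective (P1 n) (P1_bijective n)).apply_symm_apply (P0 x α)

/-- The recursion operator is self-adjoint for the canonical pairing, because both bi-vectors are
skew-symmetric. -/
theorem recursionOp_adjoint {n : ℕ} (x : Phase n) (α β : Covector n) :
    β (P1 n (recursionOp x α)) = recursionOp x β (P1 n α) := by
  rw [P1_recursionOp, P0_skew, P1_skew α, P1_recursionOp]

theorem recursionOp_pow_adjoint {n : ℕ} (x : Phase n) (α β : Covector n) (k : ℕ) :
    β (P1 n ((recursionOp x ^ k) α)) = (recursionOp x ^ k) β (P1 n α) := by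
  induction k generalizing α β with
  | zero => rfl
  | succ k ih =>
    rw [pow_succ, Module.End.mul_apply, ih, recursionOp_adjoint, ← Module.End.mul_apply,
      ← pow_succ', pow_succ]

/-- All the covectors `S ^ k α` are in involution: moving powers of `S` to one side turns the
pairing of two of them into `(S ^ (i + j) α, α)` and into `(α, S ^ (i + j) α)`, which are opposite
to each other. -/
theorem recursionOp_pow_involution {n : ℕ} (x : Phase n) (α : Covector n) (i j : ℕ) :
    (recursionOp x ^ i) α (P1 n ((recursionOp x ^ j) α)) = 0 := by
  have h1 : (recursionOp x ^ i) α (P1 n ((recursionOp x ^ j) α)) =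
      (recursionOp x ^ (i + j)) α (P1 n α) := by
    rw [recursionOp_pow_adjoint, ← Module.End.mul_apply, ← pow_add, add_comm]
  have h2 : (recursionOp x ^ i) α (P1 n ((recursionOp x ^ j) α)) =
      α (P1 n ((recursionOp x ^ (i + j)) α)) := by
    rw [← recursionOp_pow_adjoint, ← Module.End.mul_apply, ← pow_add]
  have h3 := P1_skew ((recursionOp x ^ (i + j)) α) α
  linarith

/-- The sign of `j - i`, which is the sign of `q_i - q_j` in the region `q_1 > ⋯ > q_n`. -/
def idxSign {n : ℕ} (i j : Fin n) : ℝ := if i < j then 1 else if j < i then -1 else 0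

@[simp] theorem idxSign_self {n : ℕ} (i : Fin n) : idxSign i i = 0 := by simp [idxSign]

theorem idxSign_comm {n : ℕ} (i j : Fin n) : idxSign j i = -idxSign i j := by
  rcases lt_trichotomy i j with h | h | h
  · simp [idxSign, h, h.not_gt]
  · simp [h]
  · simp [idxSign, h, h.not_gt]

/-- The kernel `exp (-|q_i - q_j| / 2)`, with the absolute value resolved as in the region
`q_1 > ⋯ > q_n`; in this form it is smooth on the whole phase space. -/
def halfExp {n : ℕ} (x : Phase n) (i j : Fin n) : ℝ :=
  Real.exp (-(idxSign i j * (x.1 i - x.1 j)) / 2)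

@[simp] theorem halfExp_self {n : ℕ} (x : Phase n) (i : Fin n) : halfExp x i i = 1 := by
  simp [halfExp]

theorem halfExp_comm {n : ℕ} (x : Phase n) (i j : Fin n) : halfExp x j i = halfExp x i j := by
  rw [halfExp, halfExp, idxSign_comm]
  ring_nf

theorem abs_sub_eq_of_mem_region {n : ℕ} {x : Phase n} (hx : x ∈ region n) (i j : Fin n) :
    |x.1 i - x.1 j| = idxSign i j * (x.1 i - x.1 j) := by
  rcases lt_trichotomy i j with h | h | h
  · rw [abs_of_pos (by linarith [hx i j h])]; simp [idxSign, h]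
  · simp [h]
  · rw [abs_of_neg (by linarith [hx j i h])]; simp [idxSign, h, h.not_gt]

theorem halfExp_eq {n : ℕ} {x : Phase n} (hx : x ∈ region n) (i j : Fin n) :
    halfExp x i j = Real.exp (-|x.1 i - x.1 j| / 2) := by
  rw [abs_sub_eq_of_mem_region hx, halfExp]

theorem halfExp_sq {n : ℕ} {x : Phase n} (hx : x ∈ region n) (i j : Fin n) :
    Real.exp (-|x.1 i - x.1 j|) = halfExp x i j ^ 2 := by
  rw [halfExp_eq hx, ← Real.exp_nat_mul]
  congr 1; push_cast; ring

theorem halfExp_mul {n : ℕ} (x : Phase n) {i j k : Fin n} (hij : i < j) (hjk : j < k) :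
    halfExp x i k = halfExp x i j * halfExp x j k := by
  rw [halfExp, halfExp, halfExp, ← Real.exp_add]
  simp only [idxSign, hij, hjk, hij.trans hjk, if_true]
  congr 1; ring

theorem real_sign_of_lt {n : ℕ} {x : Phase n} (hx : x ∈ region n) {i j : Fin n} (h : i < j) :
    Real.sign (x.1 i - x.1 j) = 1 := Real.sign_of_pos (by linarith [hx i j h])

/-- A component of a sum of elementary bi-vectors over the pairs `i < j`. -/
theorem sum_sum_lt_mul_single {n : ℕ} (c : Fin n → Fin n → ℝ) (a : Fin n → ℝ) (k : Fin n) :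
    (∑ i, ∑ j, if i < j then c i j * ((1 / 2) * (a i * (Pi.single j 1 : Fin n → ℝ) k -
      a j * (Pi.single i 1 : Fin n → ℝ) k)) else 0) =
    (1 / 2) * ((∑ i, if i < k then c i k * a i else 0) -
      ∑ i, if k < i then c k i * a i else 0) := by
  have h : ∀ i j, (if i < j then c i j * ((1 / 2) * (a i * (Pi.single j 1 : Fin n → ℝ) k -
      a j * (Pi.single i 1 : Fin n → ℝ) k)) else 0) =
      (if k = j then (if i < j then (1 / 2) * (c i j * a i) else 0) else 0) -
      (if k = i then (if i < j then (1 / 2) * (c i j * a j) else 0) else 0) := fun i j => by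
    simp only [Pi.single_apply]
    split_ifs <;> ring
  simp only [h, Finset.sum_sub_distrib, Finset.sum_ite_eq, Finset.mem_univ, if_true]
  rw [Finset.sum_comm (f := fun i j => if k = i then _ else _)]
  simp only [Finset.sum_ite_eq, Finset.mem_univ, if_true, mul_sub, Finset.mul_sum, mul_ite,
    mul_zero]

/-- The `q`-components of `P_0 α`. -/
theorem P0_fst {n : ℕ} {x : Phase n} (hx : x ∈ region n) (α : Covector n) (j : Fin n) :
    (P0 x α).1 j = (1 / 2) * (∑ i, x.2 i * halfExp x i j ^ 2 * α (dp i) +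
      ∑ i, idxSign i j * (halfExp x i j ^ 2 - 1) * α (dq i)) := by
  have h1 : (P0 x α).1 j = (∑ i, ∑ k, x.2 i * halfExp x i k ^ 2 *
        ((1 / 2) * (α (dp i) * (Pi.single k 1 : Fin n → ℝ) j))) +
      ∑ i, ∑ k, if i < k then (Real.sign (x.1 i - x.1 k) * (halfExp x i k ^ 2 - 1)) *
        ((1 / 2) * (α (dq i) * (Pi.single k 1 : Fin n → ℝ) j -
          α (dq k) * (Pi.single i 1 : Fin n → ℝ) j)) else 0 := by
    simp only [P0, wedge, halfExp_sq hx, LinearMap.add_apply, LinearMap.sub_apply,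
      LinearMap.sum_apply, apply_ite (fun f : Covector n →ₗ[ℝ] Phase n => f α),
      LinearMap.smul_apply, LinearMap.coe_mk, AddHom.coe_mk, LinearMap.zero_apply, Prod.fst_add,
      Prod.fst_sub, Prod.fst_sum, apply_ite (fun v : Phase n => v.1), Prod.smul_fst, Prod.fst_zero,
      Pi.add_apply, Pi.sub_apply, Finset.sum_apply, Pi.smul_apply, smul_eq_mul, dp, dq,
      apply_ite (fun v : Fin n → ℝ => v j), Pi.zero_apply, mul_zero, sub_zero, ite_self,
      Finset.sum_const_zero]
  rw [h1, sum_sum_lt_mul_single, mul_add, ← Finset.sum_sub_distrib]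
  congr 1
  · simp only [Pi.single_apply, mul_ite, mul_one, mul_zero, Finset.sum_ite_eq, Finset.mem_univ,
      if_true, Finset.mul_sum]
    exact Finset.sum_congr rfl fun i _ => by ring
  · congr 1
    refine Finset.sum_congr rfl fun i _ => ?_
    rcases lt_trichotomy i j with h | h | h
    · simp [idxSign, h, h.not_gt, real_sign_of_lt hx h]
    · simp [h]
    · simp [idxSign, h, h.not_gt, real_sign_of_lt hx h, halfExp_comm x i j]
      ring

/-- The `p`-components of `P_0 α`. -/
theorem P0_snd {n : ℕ} {x : Phase n} (hx : x ∈ region n) (α : Covector n) (j : Fin n) :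
    (P0 x α).2 j = -((1 / 2) * (x.2 j * (∑ i, halfExp x i j ^ 2 * α (dq i) +
      ∑ i, idxSign i j * x.2 i * halfExp x i j ^ 2 * α (dp i)))) := by
  have h1 : (P0 x α).2 j = -(∑ i, ∑ k, x.2 i * halfExp x i k ^ 2 *
        ((1 / 2) * (α (dq k) * (Pi.single i 1 : Fin n → ℝ) j))) -
      ∑ i, ∑ k, if i < k then
        (Real.sign (x.1 i - x.1 k) * x.2 i * x.2 k * halfExp x i k ^ 2) *
        ((1 / 2) * (α (dp i) * (Pi.single k 1 : Fin n → ℝ) j -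
          α (dp k) * (Pi.single i 1 : Fin n → ℝ) j)) else 0 := by
    simp only [P0, wedge, halfExp_sq hx, LinearMap.add_apply, LinearMap.sub_apply,
      LinearMap.sum_apply, apply_ite (fun f : Covector n →ₗ[ℝ] Phase n => f α),
      LinearMap.smul_apply, LinearMap.coe_mk, AddHom.coe_mk, LinearMap.zero_apply, Prod.snd_add,
      Prod.snd_sub, Prod.snd_sum, apply_ite (fun v : Phase n => v.2), Prod.smul_snd, Prod.snd_zero,
      Pi.add_apply, Pi.sub_apply, Finset.sum_apply, Pi.smul_apply, smul_eq_mul, dp, dq,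
      apply_ite (fun v : Fin n → ℝ => v j), Pi.zero_apply, mul_zero, zero_sub, sub_zero, ite_self,
      Finset.sum_const_zero, add_zero, mul_neg, Finset.sum_neg_distrib]
  rw [h1, sum_sum_lt_mul_single, ← Finset.sum_sub_distrib, sub_eq_add_neg, ← neg_add, mul_add,
    mul_add]
  congr 2
  · rw [Finset.sum_comm]
    simp only [Pi.single_apply, mul_ite, mul_one, mul_zero, Finset.sum_ite_eq, Finset.mem_univ,
      if_true, Finset.mul_sum, halfExp_comm x j]
    exact Finset.sum_congr rfl fun i _ => by ring
  · congr 1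
    rw [Finset.mul_sum]
    refine Finset.sum_congr rfl fun i _ => ?_
    rcases lt_trichotomy i j with h | h | h
    · simp [idxSign, h, h.not_gt, real_sign_of_lt hx h]
      ring
    · simp [h]
    · simp [idxSign, h, h.not_gt, real_sign_of_lt hx h, halfExp_comm x i j]
      ring

/-! ### The two kernel identities behind the recursion -/

/-- The kernel is multiplicative along increasing indices, so of the three values at a triple of
indices one is always the product of the other two. -/
theorem halfExp_triple {n : ℕ} (x : Phase n) (j i l : Fin n) :
    (i < l → l < j → halfExp x i j = halfExp x i l * halfExp x l j) ∧
    (l < i → i < j → halfExp x l j = halfExp x i l * halfExp x i j) ∧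
    (i < j → j < l → halfExp x i l = halfExp x i j * halfExp x l j) ∧
    (l < j → j < i → halfExp x i l = halfExp x i j * halfExp x l j) ∧
    (j < i → i < l → halfExp x l j = halfExp x i j * halfExp x i l) ∧
    (j < l → l < i → halfExp x i j = halfExp x l j * halfExp x i l) := by
  refine ⟨fun h h' => halfExp_mul x h h', fun h h' => ?_, fun h h' => ?_, fun h h' => ?_,
    fun h h' => ?_, fun h h' => ?_⟩
  · rw [halfExp_mul x h h', halfExp_comm x i l]
  · rw [halfExp_mul x h h', halfExp_comm x l j]
  · rw [← halfExp_comm, halfExp_mul x h h', halfExp_comm x i j, mul_comm]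
  · rw [← halfExp_comm, halfExp_mul x h h', halfExp_comm x i j]
  · rw [← halfExp_comm, halfExp_mul x h h', halfExp_comm x l j, halfExp_comm x i l]

/-- The identity between the values of the kernel at the pairs of three points that yields the
recursion for the derivatives in `p`. -/
theorem halfExp_identity_p {n : ℕ} (x : Phase n) (j i l : Fin n) :
    2 * (halfExp x i j * halfExp x l j) = halfExp x i l * (halfExp x i j ^ 2 + halfExp x l j ^ 2
      - idxSign i l * (idxSign i j * (halfExp x i j ^ 2 - 1)
        - idxSign l j * (halfExp x l j ^ 2 - 1))) := by
  obtain ⟨h1, h2, h3, h4, h5, h6⟩ := halfExp_triple x j i l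
  rcases lt_trichotomy i l with h | rfl | h
  · rcases lt_trichotomy i j with h' | rfl | h'
    · rcases lt_trichotomy l j with h'' | rfl | h''
      · simp [idxSign, h, h', h'', h1 h h'']; ring
      · simp [idxSign, h]; ring
      · simp [idxSign, h, h', h'', h''.not_gt, h3 h' h'']; ring
    · simp [idxSign, h, h.not_gt, halfExp_comm x i l]; ring
    · simp [idxSign, h, h', h'.not_gt, h'.trans h, (h'.trans h).not_gt, h5 h' h]; ring
  · simp; ring
  · rcases lt_trichotomy l j with h' | rfl | h'
    · rcases lt_trichotomy i j with h'' | rfl | h''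
      · simp [idxSign, h, h', h.not_gt, h'', h2 h h'']; ring
      · simp [idxSign, h, h.not_gt, halfExp_comm x l i]; ring
      · simp [idxSign, h, h.not_gt, h', h'', h''.not_gt, h4 h' h'']; ring
    · simp [idxSign, h, h.not_gt]; ring
    · simp [idxSign, h, h.not_gt, h', h'.not_gt, h'.trans h, (h'.trans h).not_gt, h6 h' h]; ring

/-- The identity between the values of the kernel at the pairs of three points that yields the
recursion for the derivatives in `q`. -/
theorem halfExp_identity_q {n : ℕ} (x : Phase n) (j i l : Fin n) :
    (idxSign i j + idxSign l j) * (halfExp x i j * halfExp x l j) =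
      halfExp x i l * (idxSign i j * halfExp x i j ^ 2 + idxSign l j * halfExp x l j ^ 2
        - idxSign i l * (halfExp x i j ^ 2 - halfExp x l j ^ 2)) := by
  obtain ⟨h1, h2, h3, h4, h5, h6⟩ := halfExp_triple x j i l
  rcases lt_trichotomy i l with h | rfl | h
  · rcases lt_trichotomy i j with h' | rfl | h'
    · rcases lt_trichotomy l j with h'' | rfl | h''
      · simp [idxSign, h, h', h'', h1 h h'']; ring
      · simp [idxSign, h]
      · simp [idxSign, h, h', h'', h''.not_gt, h3 h' h'']
    · simp [idxSign, h, h.not_gt, halfExp_comm x i l]; ring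
    · simp [idxSign, h, h', h'.not_gt, h'.trans h, (h'.trans h).not_gt, h5 h' h]; ring
  · simp; ring
  · rcases lt_trichotomy l j with h' | rfl | h'
    · rcases lt_trichotomy i j with h'' | rfl | h''
      · simp [idxSign, h, h', h.not_gt, h'', h2 h h'']; ring
      · simp [idxSign, h, h.not_gt, halfExp_comm x l i]
      · simp [idxSign, h, h.not_gt, h', h'', h''.not_gt, h4 h' h'']; right; ring
    · simp [idxSign, h, h.not_gt]; ring
    · simp [idxSign, h, h.not_gt, h', h'.not_gt, h'.trans h, (h'.trans h).not_gt, h6 h' h]; ring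

/-! ### Traces of powers of the Lax matrix -/

/-- The entries of a power of a differentiable matrix-valued function are differentiable. The
derivative `D` of the power is a sum over the place of the differentiated factor, and in a trace
against a matrix `B` that commutes with `A x` all its terms become equal. -/
theorem exists_hasFDerivAt_matrix_pow {V ι : Type*} [NormedAddCommGroup V] [NormedSpace ℝ V]
    [Fintype ι] [DecidableEq ι] {A : V → Matrix ι ι ℝ} {A' : ι → ι → V →L[ℝ] ℝ} {x : V}
    (h : ∀ i j, HasFDerivAt (fun y => A y i j) (A' i j) x) (m : ℕ) :
    ∃ D : ι → ι → V →L[ℝ] ℝ, (∀ i j, HasFDerivAt (fun y => (A y ^ (m + 1)) i j) (D i j) x) ∧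
      ∀ v, ∀ B : Matrix ι ι ℝ, Commute B (A x) →
        (B * of fun i j => D i j v).trace =
          (m + 1) * (B * A x ^ m * of fun i j => A' i j v).trace := by
  induction m with
  | zero => exact ⟨A', by simpa using h, fun v B _ => by simp⟩
  | succ m ih =>
    obtain ⟨D, hD, hB⟩ := ih
    refine ⟨fun i j => ∑ k, (A x i k • D k j + (A x ^ (m + 1)) k j • A' i k), fun i j => ?_,
      fun v B hBA => ?_⟩
    · have h1 : (fun y => (A y ^ (m + 1 + 1)) i j) =
          fun y => ∑ k, A y i k * (A y ^ (m + 1)) k j := by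
        funext y
        rw [pow_succ', mul_apply]
      rw [h1]
      exact HasFDerivAt.fun_sum fun k _ => (h i k).mul (hD k j)
    · have h1 : (of fun i j => (∑ k, (A x i k • D k j + (A x ^ (m + 1)) k j • A' i k)) v) =
          A x * (of fun i j => D i j v) + (of fun i j => A' i j v) * A x ^ (m + 1) := by
        ext i j
        simp [mul_apply, Finset.sum_add_distrib, mul_comm]
      have h2 : (B * ((of fun i j => A' i j v) * A x ^ (m + 1))).trace =
          (B * A x ^ (m + 1) * of fun i j => A' i j v).trace := by
        rw [← Matrix.mul_assoc, trace_mul_comm, ← Matrix.mul_assoc, (hBA.pow_right (m + 1)).eq]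
      have h3 := hB v (B * A x) (hBA.mul_left (Commute.refl _))
      rw [h1, Matrix.mul_add, trace_add, h2, ← Matrix.mul_assoc, h3, pow_succ',
        ← Matrix.mul_assoc]
      push_cast
      ring

/-- The derivative of the trace of a power of a matrix-valued function. -/
theorem hasFDerivAt_trace_pow {V ι : Type*} [NormedAddCommGroup V] [NormedSpace ℝ V] [Fintype ι]
    [DecidableEq ι] {A : V → Matrix ι ι ℝ} {A' : ι → ι → V →L[ℝ] ℝ} {x : V}
    (h : ∀ i j, HasFDerivAt (fun y => A y i j) (A' i j) x) (m : ℕ) :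
    HasFDerivAt (fun y => (A y ^ (m + 1)).trace)
      (((m : ℝ) + 1) • ∑ i, ∑ j, (A x ^ m) j i • A' i j) x := by
  obtain ⟨D, hD, hB⟩ := exists_hasFDerivAt_matrix_pow h m
  have hT : HasFDerivAt (fun y => (A y ^ (m + 1)).trace) (∑ i, D i i) x :=
    HasFDerivAt.fun_sum fun i _ => hD i i
  refine hT.congr_fderiv (ContinuousLinearMap.ext fun v => ?_)
  have h1 := hB v 1 (Commute.one_left _)
  simp only [one_mul, trace, diag_apply, of_apply, mul_apply] at h1
  rw [_root_.sum_apply, h1, Finset.sum_comm]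
  simp [_root_.sum_apply]

/-- The matrix of the values of the kernel, `(exp (-|q_i - q_j| / 2))` in the region. -/
def kernelMatrix {n : ℕ} (x : Phase n) : Matrix (Fin n) (Fin n) ℝ := of (halfExp x)

/-- The Lax matrix of the peakon system, `(exp (-|q_i - q_j| / 2) p_j)` in the region. -/
def laxMatrix {n : ℕ} (x : Phase n) : Matrix (Fin n) (Fin n) ℝ := kernelMatrix x * diagonal x.2

/-- The function `tr L ^ (s + 1) / (s + 1)`, where `L` is the Lax matrix. -/
def traceIntegral {n : ℕ} (s : ℕ) (x : Phase n) : ℝ := (laxMatrix x ^ (s + 1)).trace / (s + 1)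

theorem laxMatrix_apply {n : ℕ} (x : Phase n) (i j : Fin n) :
    laxMatrix x i j = halfExp x i j * x.2 j := by
  simp [laxMatrix, kernelMatrix]

/-- The symmetric matrix `D L ^ s`, where `D` is the diagonal matrix of the momenta. -/
def symmPow {n : ℕ} (s : ℕ) (x : Phase n) : Matrix (Fin n) (Fin n) ℝ :=
  diagonal x.2 * laxMatrix x ^ s

theorem symmPow_apply {n : ℕ} (s : ℕ) (x : Phase n) (i j : Fin n) :
    symmPow s x i j = x.2 i * (laxMatrix x ^ s) i j := by
  simp [symmPow]

theorem kernelMatrix_transpose {n : ℕ} (x : Phase n) : (kernelMatrix x)ᵀ = kernelMatrix x := by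
  ext i j
  simp [kernelMatrix, halfExp_comm x i j]

/-- The matrix `D (E D) ^ s` equals `(D E) ^ s D`, its transpose. -/
theorem symmPow_transpose {n : ℕ} (s : ℕ) (x : Phase n) : (symmPow s x)ᵀ = symmPow s x := by
  have h : SemiconjBy (diagonal x.2) (laxMatrix x) (diagonal x.2 * kernelMatrix x) :=
    (mul_assoc _ _ _).symm
  rw [symmPow, transpose_mul, transpose_pow, laxMatrix, transpose_mul, kernelMatrix_transpose,
    diagonal_transpose]
  exact (h.pow_right s).symm

theorem symmPow_comm {n : ℕ} (s : ℕ) (x : Phase n) (i j : Fin n) :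
    symmPow s x j i = symmPow s x i j := by
  conv_rhs => rw [← symmPow_transpose]
  rfl

/-- The differential of the position `q_i`. -/
def qCoord {n : ℕ} (i : Fin n) : Covector n :=
  (ContinuousLinearMap.proj (R := ℝ) (φ := fun _ => ℝ) i).comp
    (ContinuousLinearMap.fst ℝ (Fin n → ℝ) (Fin n → ℝ))

/-- The differential of the momentum `p_i`. -/
def pCoord {n : ℕ} (i : Fin n) : Covector n :=
  (ContinuousLinearMap.proj (R := ℝ) (φ := fun _ => ℝ) i).comp
    (ContinuousLinearMap.snd ℝ (Fin n → ℝ) (Fin n → ℝ))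

theorem qCoord_apply {n : ℕ} (i : Fin n) (v : Phase n) : qCoord i v = v.1 i := rfl

theorem pCoord_apply {n : ℕ} (i : Fin n) (v : Phase n) : pCoord i v = v.2 i := rfl

/-- The differential of an entry of the Lax matrix. -/
def laxDeriv {n : ℕ} (x : Phase n) (i j : Fin n) : Covector n :=
  halfExp x i j • pCoord j +
    (x.2 j * (halfExp x i j * (-idxSign i j / 2))) • (qCoord i - qCoord j)

theorem hasFDerivAt_laxMatrix {n : ℕ} (x : Phase n) (i j : Fin n) :
    HasFDerivAt (fun y => laxMatrix y i j) (laxDeriv x i j) x := by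
  have hq : ∀ k : Fin n, HasFDerivAt (fun y : Phase n => y.1 k) (qCoord k) x :=
    fun k => (qCoord k).hasFDerivAt
  have hp : HasFDerivAt (fun y : Phase n => y.2 j) (pCoord j) x := (pCoord j).hasFDerivAt
  have he := (((hq i).sub (hq j)).const_mul (-idxSign i j / 2)).exp
  have h : (fun y => laxMatrix y i j) =
      fun y => Real.exp (-idxSign i j / 2 * (y.1 i - y.1 j)) * y.2 j := by
    funext y
    rw [laxMatrix_apply, halfExp]
    ring_nf
  rw [h]
  refine (he.mul hp).congr_fderiv ?_
  have hx : Real.exp (-idxSign i j / 2 * (x.1 i - x.1 j)) = halfExp x i j := by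
    rw [halfExp]
    ring_nf
  simp only [Pi.sub_apply, hx, laxDeriv, smul_smul]

/-- The differential of `tr L ^ (s + 1) / (s + 1)`. -/
def traceDeriv {n : ℕ} (s : ℕ) (x : Phase n) : Covector n :=
  ∑ i, ∑ j, (laxMatrix x ^ s) j i • laxDeriv x i j

theorem hasFDerivAt_traceIntegral {n : ℕ} (s : ℕ) (x : Phase n) :
    HasFDerivAt (traceIntegral s) (traceDeriv s x) x := by
  have h := (hasFDerivAt_trace_pow (hasFDerivAt_laxMatrix x) s).const_mul ((s : ℝ) + 1)⁻¹
  have hs : (s : ℝ) + 1 ≠ 0 := by positivity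
  rw [smul_smul, inv_mul_cancel₀ hs, one_smul] at h
  refine h.congr_of_eventuallyEq (Filter.Eventually.of_forall fun y => ?_)
  rw [traceIntegral, div_eq_inv_mul]

theorem traceDeriv_dp {n : ℕ} (s : ℕ) (x : Phase n) (k : Fin n) :
    traceDeriv s x (dp k) = (laxMatrix x ^ s * kernelMatrix x) k k := by
  simp only [traceDeriv, laxDeriv, dp, _root_.sum_apply, kernelMatrix, mul_apply,
    _root_.smul_apply, _root_.add_apply, _root_.sub_apply,
    qCoord_apply, pCoord_apply, Pi.zero_apply, Pi.single_apply, smul_eq_mul, sub_zero, mul_zero,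
    add_zero, mul_ite, mul_one, Finset.sum_ite_eq', Finset.mem_univ, if_true, of_apply]

theorem mul_traceDeriv_dp {n : ℕ} (s : ℕ) (x : Phase n) (k : Fin n) :
    x.2 k * traceDeriv s x (dp k) = ∑ l, symmPow s x k l * halfExp x k l := by
  rw [traceDeriv_dp, mul_apply, Finset.mul_sum]
  refine Finset.sum_congr rfl fun l _ => ?_
  rw [symmPow_apply, kernelMatrix, of_apply, halfExp_comm x k l, mul_assoc]

/-- Both rows and columns of the Lax matrix depend on `q_k`; by the symmetry of `D L ^ s` they
contribute the same amount. -/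
theorem traceDeriv_dq {n : ℕ} (s : ℕ) (x : Phase n) (k : Fin n) :
    traceDeriv s x (dq k) = ∑ i, idxSign i k * halfExp x i k * symmPow s x i k := by
  have h : traceDeriv s x (dq k) = ∑ i, ∑ j,
      ((if i = k then (1 / 2) * (idxSign j i * halfExp x j i * symmPow s x j i) else 0) +
        if j = k then (1 / 2) * (idxSign i j * halfExp x i j * symmPow s x j i) else 0) := by
    simp only [traceDeriv, laxDeriv, dq, _root_.sum_apply,
      _root_.smul_apply, _root_.add_apply, _root_.sub_apply,
      qCoord_apply, pCoord_apply, Pi.zero_apply, Pi.single_apply, smul_eq_mul, mul_zero,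
      zero_add]
    refine Finset.sum_congr rfl fun i _ => Finset.sum_congr rfl fun j _ => ?_
    rw [symmPow_apply, halfExp_comm x i j, idxSign_comm i j]
    split_ifs <;> ring
  rw [h]
  simp only [Finset.sum_add_distrib, Finset.sum_ite_eq', Finset.mem_univ, if_true]
  rw [Finset.sum_comm]
  simp only [Finset.sum_ite_eq', Finset.mem_univ, if_true, ← Finset.sum_add_distrib]
  refine Finset.sum_congr rfl fun i _ => ?_
  rw [symmPow_comm s x i k]
  ring

/-! ### The recursion relation -/

/-- Against a symmetric matrix only the symmetric part of a kernel matters. -/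
theorem sum_mul_eq_of_symm {ι : Type*} [Fintype ι] {N g h : ι → ι → ℝ} (hN : ∀ i l, N l i = N i l)
    (hgh : ∀ i l, g i l + g l i = h i l + h l i) :
    ∑ i, ∑ l, N i l * g i l = ∑ i, ∑ l, N i l * h i l := by
  have key : ∀ f : ι → ι → ℝ,
      2 * ∑ i, ∑ l, N i l * f i l = ∑ i, ∑ l, N i l * (f i l + f l i) := fun f => by
    have h1 : ∑ i, ∑ l, N i l * f i l = ∑ i, ∑ l, N i l * f l i := by
      rw [Finset.sum_comm]
      exact Finset.sum_congr rfl fun i _ => Finset.sum_congr rfl fun l _ => by rw [hN]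
    simp only [mul_add, Finset.sum_add_distrib]
    rw [← h1, two_mul]
  have h1 := key g
  have h2 := key h
  simp only [hgh] at h1
  linarith

/-- The matrix `L ^ (s + 1) E` equals `E N E` with `N = D L ^ s`. -/
theorem traceDeriv_succ_dp {n : ℕ} (s : ℕ) (x : Phase n) (j : Fin n) :
    traceDeriv (s + 1) x (dp j) = ∑ i, ∑ l, symmPow s x i l * (halfExp x i j * halfExp x l j) := by
  have h : laxMatrix x ^ (s + 1) * kernelMatrix x =
      kernelMatrix x * (symmPow s x * kernelMatrix x) := by
    rw [pow_succ', symmPow, laxMatrix]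
    simp only [Matrix.mul_assoc]
  rw [traceDeriv_dp, h, mul_apply]
  simp only [mul_apply, Finset.mul_sum, kernelMatrix, of_apply]
  refine Finset.sum_congr rfl fun i _ => Finset.sum_congr rfl fun l _ => ?_
  rw [halfExp_comm x i j]
  ring

/-- The matrix `D L ^ (s + 1)` equals `D E N` with `N = D L ^ s`. -/
theorem traceDeriv_succ_dq {n : ℕ} (s : ℕ) (x : Phase n) (j : Fin n) :
    traceDeriv (s + 1) x (dq j) = x.2 j *
      ∑ i, ∑ l, symmPow s x i l * (idxSign i j * (halfExp x i j * halfExp x l j)) := by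
  have h : symmPow (s + 1) x = diagonal x.2 * (kernelMatrix x * symmPow s x) := by
    rw [symmPow, symmPow, pow_succ', laxMatrix]
    simp only [Matrix.mul_assoc]
  rw [traceDeriv_dq, Finset.mul_sum]
  refine Finset.sum_congr rfl fun i _ => ?_
  rw [← symmPow_comm (s + 1), h, diagonal_mul, mul_apply]
  simp only [Finset.mul_sum, kernelMatrix, of_apply]
  refine Finset.sum_congr rfl fun l _ => ?_
  rw [halfExp_comm x l j, symmPow_comm s x i l]
  ring

/-- The differentials of the normalized traces satisfy the recursion `dF_{s+1} = S (dF_s)`. -/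
theorem recursionOp_traceDeriv {n : ℕ} {x : Phase n} (hx : x ∈ region n) (s : ℕ) :
    recursionOp x (traceDeriv s x) = traceDeriv (s + 1) x := by
  -- after applying `P_1`, both sides are sums of the entries of `D L ^ s` against some kernels,
  -- whose symmetrizations are compared
  refine (P1_bijective n).1 ?_
  rw [P1_recursionOp]
  refine Prod.ext (funext fun j => ?_) (funext fun j => ?_)
  · rw [P0_fst hx, P1_fst, traceDeriv_succ_dp]
    congr 1
    rw [← Finset.sum_add_distrib, ← sum_mul_eq_of_symm (N := symmPow s x)
      (g := fun i l => halfExp x i l * (halfExp x i j ^ 2 +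
        idxSign i j * (halfExp x i j ^ 2 - 1) * idxSign l i)) (fun i l => symmPow_comm s x i l)]
    · refine Finset.sum_congr rfl fun i _ => ?_
      have h1 := mul_traceDeriv_dp s x i
      rw [show x.2 i * halfExp x i j ^ 2 * traceDeriv s x (dp i) =
        halfExp x i j ^ 2 * (x.2 i * traceDeriv s x (dp i)) by ring, h1, traceDeriv_dq,
        Finset.mul_sum, Finset.mul_sum, ← Finset.sum_add_distrib]
      refine Finset.sum_congr rfl fun l _ => ?_
      rw [symmPow_comm s x i l, halfExp_comm x i l]
      ring
    · intro i l
      have := halfExp_identity_p x j i l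
      rw [halfExp_comm x i l, idxSign_comm i l]
      linarith
  · rw [P0_snd hx, P1_snd, traceDeriv_succ_dq]
    congr 3
    rw [← Finset.sum_add_distrib, ← sum_mul_eq_of_symm (N := symmPow s x)
      (g := fun i l => halfExp x i l * (halfExp x i j ^ 2 * idxSign l i +
        idxSign i j * halfExp x i j ^ 2)) (fun i l => symmPow_comm s x i l)]
    · refine Finset.sum_congr rfl fun i _ => ?_
      have h1 := mul_traceDeriv_dp s x i
      rw [show idxSign i j * x.2 i * halfExp x i j ^ 2 * traceDeriv s x (dp i) =
        idxSign i j * halfExp x i j ^ 2 * (x.2 i * traceDeriv s x (dp i)) by ring, h1,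
        traceDeriv_dq, Finset.mul_sum, Finset.mul_sum, ← Finset.sum_add_distrib]
      refine Finset.sum_congr rfl fun l _ => ?_
      rw [symmPow_comm s x i l, halfExp_comm x i l]
      ring
    · intro i l
      have := halfExp_identity_q x j i l
      rw [halfExp_comm x i l, idxSign_comm i l]
      linarith

theorem traceDeriv_eq_pow {n : ℕ} {x : Phase n} (hx : x ∈ region n) (s k : ℕ) :
    (recursionOp x ^ k) (traceDeriv s x) = traceDeriv (s + k) x := by
  induction k with
  | zero => rfl
  | succ k ih =>
    rw [pow_succ', Module.End.mul_apply, ih, recursionOp_traceDeriv hx, add_assoc]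

/-! ### The sequence of integrals -/

theorem isOpen_region (n : ℕ) : IsOpen (region n) := by
  simp only [region, Set.ofPred_forall]
  exact isOpen_iInter_of_finite fun i => isOpen_iInter_of_finite fun j =>
    isOpen_iInter_of_finite fun _ => isOpen_lt (by fun_prop) (by fun_prop)

theorem convex_region (n : ℕ) : Convex ℝ (region n) := by
  intro x hx y hy a b ha hb hab i j hij
  have h1 := hx i j hij
  have h2 := hy i j hij
  simp only [Prod.fst_add, Prod.smul_fst, Pi.add_apply, Pi.smul_apply, smul_eq_mul]
  rcases ha.eq_or_lt with rfl | ha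
  · rw [zero_add] at hab
    subst hab
    linarith
  · have := mul_lt_mul_of_pos_left h1 ha
    have := mul_le_mul_of_nonneg_left h2.le hb
    linarith

theorem traceIntegral_zero {n : ℕ} (x : Phase n) : traceIntegral 0 x = momentum x := by
  simp [traceIntegral, momentum, trace, laxMatrix_apply]

theorem traceIntegral_one {n : ℕ} {x : Phase n} (hx : x ∈ region n) :
    traceIntegral 1 x = energy x := by
  simp only [traceIntegral, energy, trace, diag_apply, pow_succ, pow_zero, one_mul, mul_apply,
    laxMatrix_apply, halfExp_sq hx, Nat.cast_one, Finset.sum_div, Finset.mul_sum]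
  refine Finset.sum_congr rfl fun i _ => Finset.sum_congr rfl fun j _ => ?_
  rw [halfExp_comm x i j]
  ring

theorem traceIntegral_momentum_zero {n : ℕ} (s : ℕ) (q : Fin n → ℝ) :
    traceIntegral s (q, 0) = 0 := by
  have h : laxMatrix ((q, 0) : Phase n) = 0 := by
    ext i j
    simp [laxMatrix_apply]
  rw [traceIntegral, h, zero_pow (Nat.succ_ne_zero s), trace_zero, zero_div]

theorem fderiv_energy {n : ℕ} {x : Phase n} (hx : x ∈ region n) :
    fderiv ℝ energy x = traceDeriv 1 x := by
  refine ((hasFDerivAt_traceIntegral 1 x).congr_of_eventuallyEq ?_).fderiv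
  filter_upwards [(isOpen_region n).mem_nhds hx] with y hy
  rw [traceIntegral_one hy]

theorem hamiltonField_eq {n : ℕ} (x : Phase n) :
    hamiltonField x = (2 : ℝ) • P1 n (fderiv ℝ energy x) := by
  refine Prod.ext (funext fun i => ?_) (funext fun i => ?_)
  · rw [Prod.smul_fst, Pi.smul_apply, P1_fst, smul_eq_mul, hamiltonField]
    ring
  · rw [Prod.smul_snd, Pi.smul_apply, P1_snd, smul_eq_mul, hamiltonField]
    ring

theorem isRecursionSequence_traceIntegral (n : ℕ) : IsRecursionSequence n traceIntegral where
  zero x _ := traceIntegral_zero x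
  one _ hx := traceIntegral_one hx
  hasFDerivAt i x hx := by
    rw [fderiv_energy hx, traceDeriv_eq_pow hx, add_comm 1 i]
    exact hasFDerivAt_traceIntegral (i + 1) x
  normalized i q _ := traceIntegral_momentum_zero i q

/-- The difference of the two functions has zero differential on the convex region and vanishes at
`(q, 0)`. -/
theorem IsRecursionSequence.eq_traceIntegral {n : ℕ} {H : ℕ → Phase n → ℝ}
    (hH : IsRecursionSequence n H) (s : ℕ) {x : Phase n} (hx : x ∈ region n) :
    H s x = traceIntegral s x := by
  cases s with
  | zero => rw [hH.zero x hx, traceIntegral_zero]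
  | succ s =>
    have h0 : ((x.1, 0) : Phase n) ∈ region n := hx
    have hd : ∀ y ∈ region n,
        HasFDerivAt (fun z => H (s + 1) z - traceIntegral (s + 1) z) 0 y := fun y hy => by
      have := (hH.hasFDerivAt s y hy).sub
        ((isRecursionSequence_traceIntegral n).hasFDerivAt s y hy)
      rwa [sub_self] at this
    have hc := (convex_region n).is_const_of_fderivWithin_eq_zero
      (fun y hy => (hd y hy).differentiableAt.differentiableWithinAt)
      (fun y hy => by rw [fderivWithin_of_isOpen (isOpen_region n) hy, (hd y hy).fderiv]) hx h0
    simp only [hH.normalized (s + 1) x.1 h0, traceIntegral_momentum_zero, sub_zero] at hc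
    exact sub_eq_zero.1 hc

/-- The derivative along a solution is, up to a factor, the pairing of `S ^ s (dF_0)` with
`S (dF_0)`, which are in involution. -/
theorem isFirstIntegral_of_eq_traceIntegral {n : ℕ} {F : Phase n → ℝ} (s : ℕ)
    (hF : ∀ x ∈ region n, F x = traceIntegral s x) : IsFirstIntegral F := by
  intro a b γ hγ t₁ h₁ t₂ h₂
  rw [hF _ (hγ t₁ h₁).1, hF _ (hγ t₂ h₂).1]
  have hd : ∀ t ∈ Set.Ioo a b, HasDerivAt (fun t => traceIntegral s (γ t)) 0 t := fun t ht => by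
    obtain ⟨hr, hd⟩ := hγ t ht
    have h := (hasFDerivAt_traceIntegral s (γ t)).comp_hasDerivAt t hd
    have h0 : traceDeriv s (γ t) (hamiltonField (γ t)) = 0 := by
      have h1 := recursionOp_pow_involution (γ t) (traceDeriv 0 (γ t)) s 1
      rw [traceDeriv_eq_pow hr, traceDeriv_eq_pow hr, zero_add, zero_add] at h1
      rw [hamiltonField_eq, map_smul, fderiv_energy hr, h1, smul_zero]
    rwa [h0] at h
  refine (convex_Ioo a b).is_const_of_fderivWithin_eq_zero (𝕜 := ℝ)
    (f := fun t => traceIntegral s (γ t))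
    (fun t ht => (hd t ht).differentiableAt.differentiableWithinAt) (fun t ht => ?_) h₁ h₂
  rw [fderivWithin_of_isOpen isOpen_Ioo ht]
  ext
  simp [(hd t ht).deriv]

/-! ### Inserting a new largest entry into a closed path -/

/-- The multiset of the larger endpoints of the steps of the path `a, l, 0`. The last step, to `0`,
contributes its starting point. -/
def slots (a : ℕ) : List ℕ → Multiset ℕ
  | [] => {a}
  | b :: l => max a b ::ₘ slots b l

/-- The list `[s, …, 2, 1]`. -/
def downFrom : ℕ → List ℕ
  | 0 => []
  | s + 1 => (s + 1) :: downFrom s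

theorem mem_downFrom {s k : ℕ} : k ∈ downFrom s ↔ 1 ≤ k ∧ k ≤ s := by
  induction s with
  | zero => simp [downFrom]; omega
  | succ s ih => simp [downFrom, ih]; omega

theorem nodup_downFrom (s : ℕ) : (downFrom s).Nodup := by
  induction s with
  | zero => simp [downFrom]
  | succ s ih => simp [downFrom, ih, mem_downFrom]

theorem length_downFrom (s : ℕ) : (downFrom s).length = s := by
  induction s with
  | zero => rfl
  | succ s ih => rw [downFrom, List.length_cons, ih]

/-- Inserting an entry `t`, not smaller than all others, into a step of a path replaces the slot
of this step by two slots `t`. -/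
theorem sum_permutations'Aux {t : ℕ} (l : List ℕ) (hl : ∀ b ∈ l, b ≤ t) {a : ℕ} (ha : a ≤ t)
    (Ψ : Multiset ℕ → ℝ) :
    ((l.permutations'Aux t).map fun l' => Ψ (slots a l')).sum =
      ((slots a l).map fun i => Ψ (t ::ₘ t ::ₘ (slots a l).erase i)).sum := by
  induction l generalizing a Ψ with
  | nil => simp [slots, ha]
  | cons y l ih =>
    have hy : y ≤ t := hl y (by simp)
    have h := ih (fun b hb => hl b (by simp [hb])) hy fun M => Ψ (max a y ::ₘ M)
    simp only [List.permutations'Aux, List.map_cons, List.map_map, List.sum_cons, slots,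
      Function.comp_def, Multiset.map_cons, Multiset.sum_cons, Multiset.erase_cons_head,
      max_eq_right ha, max_eq_left hy] at h ⊢
    rw [h]
    congr 2
    refine Multiset.map_congr rfl fun i hi => ?_
    rw [Multiset.erase_cons_tail_of_mem hi, Multiset.cons_swap (max a y),
      Multiset.cons_swap (max a y)]

/-- The recursion for the sum of a function of the slots over all closed paths that start at `0`
and visit `1, …, s` once. -/
theorem sum_permutations'_downFrom_succ (s : ℕ) (Ψ : Multiset ℕ → ℝ) :
    ((downFrom (s + 1)).permutations'.map fun l => Ψ (slots 0 l)).sum =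
      ((downFrom s).permutations'.map fun l => ((slots 0 l).map fun i =>
        Ψ ((s + 1) ::ₘ (s + 1) ::ₘ (slots 0 l).erase i)).sum).sum := by
  rw [downFrom, List.permutations', List.map_flatMap, List.flatMap, List.sum_flatten, List.map_map]
  congr 1
  refine List.map_congr_left fun l hl => ?_
  refine sum_permutations'Aux l (fun b hb => ?_) (Nat.zero_le _) Ψ
  have := mem_downFrom.1 ((List.mem_permutations'.1 hl).mem_iff.1 hb)
  omega

/-! ### Adding a node to an increasing tree -/

/-- The number of slots of the node `j` of an increasing tree, that is, the largest number of
children it may have: one for the root, two for the other nodes. -/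
def slotCap (j : ℕ) : ℕ := if j = 0 then 1 else 2

/-- The number of children of the node `j` in the tree with parent map `ρ`. -/
def childCount {s : ℕ} (ρ : Fin s → Fin s) (j : ℕ) : ℕ :=
  (Finset.univ.filter fun k => (ρ k : ℕ) = j).card

/-- The free slots of the tree with nodes `0, …, s` and parent map `ρ`: the node `j` is repeated as
often as children can still be attached to it. The truncated subtraction matters only for overfull
nodes, and then `c_ρ = 0`. -/
def freeSlots {s : ℕ} (ρ : Fin s → Fin s) : Multiset ℕ :=
  ∑ j ∈ Finset.range (s + 1), Multiset.replicate (slotCap j - childCount ρ j) j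

theorem childCount_val {s : ℕ} (ρ : Fin s → Fin s) (j : Fin s) :
    childCount ρ j = fiberCard ρ j := by
  simp only [childCount, fiberCard, Fin.ext_iff]

theorem childCount_of_le {s : ℕ} (ρ : Fin s → Fin s) {i : ℕ} (h : s ≤ i) : childCount ρ i = 0 := by
  rw [childCount, Finset.card_eq_zero, Finset.filter_eq_empty_iff]
  intro k _
  have := (ρ k).2
  omega

/-- The coefficient `c_ρ` counts the ways to assign to the children of every node different slots
of this node. -/
theorem cRho_eq_prod {s : ℕ} (ρ : Fin s → Fin s) :
    cRho ρ = ∏ j ∈ Finset.range (s + 1), (slotCap j).descFactorial (childCount ρ j) := by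
  rw [Finset.prod_range_succ, childCount_of_le ρ le_rfl, Nat.descFactorial_zero, mul_one,
    Finset.prod_range]
  simp only [childCount_val]
  unfold cRho
  split_ifs with h
  · symm
    rw [Finset.prod_eq_zero_iff]
    rcases h with ⟨j, hj, h⟩ | ⟨j, hj, h⟩
    · exact ⟨j, Finset.mem_univ _, Nat.descFactorial_eq_zero_iff_lt.2 (by simpa [slotCap, hj])⟩
    · exact ⟨j, Finset.mem_univ _, Nat.descFactorial_eq_zero_iff_lt.2 (by simpa [slotCap, hj])⟩
  · push Not at h
    rw [sRho, Finset.card_filter, ← Finset.prod_pow_eq_pow_sum]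
    refine Finset.prod_congr rfl fun j _ => ?_
    by_cases hj : (j : ℕ) = 0
    · have := h.1 j hj
      interval_cases fiberCard ρ j <;> simp [slotCap, hj]
    · have := h.2 j hj
      interval_cases fiberCard ρ j <;> simp [slotCap, hj, Nat.descFactorial]

/-- The tree obtained by attaching the node `s + 1` to the node `j`. -/
def attach {s : ℕ} (ρ : Fin s → Fin s) (j : Fin (s + 1)) : Fin (s + 1) → Fin (s + 1) :=
  Fin.snoc (α := fun _ => Fin (s + 1)) (fun k => (ρ k).castSucc) j

theorem childCount_attach {s : ℕ} (ρ : Fin s → Fin s) (j : Fin (s + 1)) (i : ℕ) :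
    childCount (attach ρ j) i = childCount ρ i + if (j : ℕ) = i then 1 else 0 := by
  rw [childCount, childCount, Finset.card_filter, Finset.card_filter, Fin.sum_univ_castSucc]
  simp only [attach, Fin.snoc_castSucc, Fin.snoc_last, Fin.val_castSucc]

/-- Every tree on `0, …, s + 1` arises in one way from a tree on `0, …, s` by attaching `s + 1`. -/
theorem sum_rhoMaps_succ (s : ℕ) (F : (Fin (s + 1) → Fin (s + 1)) → ℝ) :
    ∑ ρ ∈ rhoMaps (s + 1), F ρ = ∑ ρ ∈ rhoMaps s, ∑ j, F (attach ρ j) := by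
  rw [← Finset.sum_product']
  symm
  refine Finset.sum_bij (fun a _ => attach a.1 a.2) ?_ ?_ ?_ fun _ _ => rfl
  · rintro ⟨ρ, j⟩ h
    simp only [rhoMaps, Finset.mem_product, Finset.mem_filter, Finset.mem_univ, true_and,
      and_true] at h ⊢
    intro k
    induction k using Fin.lastCases with
    | last => simpa [attach, Fin.lt_def] using Nat.lt_succ_iff.1 j.2
    | cast k => simpa [attach, Fin.lt_def] using h k
  · rintro ⟨ρ, j⟩ - ⟨ρ', j'⟩ - h
    obtain ⟨h1, h2⟩ := Fin.snoc_injective2 (α := fun _ => Fin (s + 1)) h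
    refine Prod.ext (funext fun k => ?_) h2
    exact Fin.castSucc_injective _ (congrFun h1 k)
  · intro ρ h
    simp only [rhoMaps, Finset.mem_filter, Finset.mem_univ, true_and] at h
    have hlt : ∀ k : Fin s, (ρ k.castSucc : ℕ) < s := fun k => by
      have := h k.castSucc
      have := k.2
      simp only [Fin.lt_def, Fin.val_castSucc, Fin.val_succ] at *
      omega
    refine ⟨(fun k => ⟨ρ k.castSucc, hlt k⟩, ρ (Fin.last s)), ?_, ?_⟩
    · simp only [rhoMaps, Finset.mem_product, Finset.mem_filter, Finset.mem_univ, true_and,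
        and_true]
      intro k
      simpa [Fin.lt_def] using h k.castSucc
    · funext k
      induction k using Fin.lastCases with
      | last => simp [attach]
      | cast k => simp [attach]

/-- The new node can occupy any of the free slots of its parent. -/
theorem cRho_attach {s : ℕ} (ρ : Fin s → Fin s) (j : Fin (s + 1)) :
    cRho (attach ρ j) = (slotCap j - childCount ρ j) * cRho ρ := by
  have hj : (j : ℕ) ∈ Finset.range (s + 1) := Finset.mem_range.2 j.2
  rw [cRho_eq_prod, cRho_eq_prod, Finset.prod_range_succ, childCount_of_le _ le_rfl,
    Nat.descFactorial_zero, mul_one, ← Finset.mul_prod_erase _ _ hj,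
    ← Finset.mul_prod_erase _ _ hj, childCount_attach, if_pos rfl, Nat.descFactorial_succ,
    mul_assoc]
  congr 2
  refine Finset.prod_congr rfl fun i hi => ?_
  rw [childCount_attach, if_neg (Finset.ne_of_mem_erase hi).symm, add_zero]

/-- The new node uses up a slot of its parent and brings two slots of its own. -/
theorem freeSlots_attach {s : ℕ} (ρ : Fin s → Fin s) (j : Fin (s + 1))
    (h : slotCap j - childCount ρ j ≠ 0) :
    freeSlots (attach ρ j) = (s + 1) ::ₘ (s + 1) ::ₘ (freeSlots ρ).erase j := by
  have hj : (j : ℕ) ∈ Finset.range (s + 1) := Finset.mem_range.2 j.2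
  rw [freeSlots, freeSlots, Finset.sum_range_succ, childCount_of_le _ le_rfl, add_comm,
    ← Finset.add_sum_erase _ _ hj, ← Finset.add_sum_erase _ _ hj, childCount_attach, if_pos rfl]
  obtain ⟨c, hc⟩ := Nat.exists_eq_succ_of_ne_zero h
  have hc' : slotCap j - (childCount ρ j + 1) = c := by omega
  rw [hc, hc', Multiset.replicate_succ, Multiset.cons_add, Multiset.erase_cons_head]
  simp only [slotCap, Nat.succ_ne_zero, if_false, Nat.sub_zero, Multiset.replicate_succ,
    Multiset.replicate_zero, Multiset.cons_add, zero_add]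
  congr 3
  refine Finset.sum_congr rfl fun i hi => ?_
  rw [childCount_attach, if_neg (Finset.ne_of_mem_erase hi).symm, add_zero]

theorem sum_freeSlots {s : ℕ} (ρ : Fin s → Fin s) (f : ℕ → ℝ) :
    ((freeSlots ρ).map f).sum =
      ∑ j : Fin (s + 1), ((slotCap j - childCount ρ j : ℕ) : ℝ) * f j := by
  rw [freeSlots, ← Multiset.coe_mapAddMonoidHom, map_sum, ← Multiset.coe_sumAddMonoidHom, map_sum,
    Finset.sum_range]
  simp only [Multiset.coe_mapAddMonoidHom, Multiset.coe_sumAddMonoidHom, Multiset.map_replicate,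
    Multiset.sum_replicate, nsmul_eq_mul]

/-- Closed paths through `0, …, s` and increasing trees on `0, …, s`, counted with the
coefficients `c_ρ`, have the same distribution of slots, because both satisfy the same recursion
in `s`. -/
theorem sum_cRho_mul_freeSlots (s : ℕ) (Ψ : Multiset ℕ → ℝ) :
    ∑ ρ ∈ rhoMaps s, (cRho ρ : ℝ) * Ψ (freeSlots ρ) =
      ((downFrom s).permutations'.map fun l => Ψ (slots 0 l)).sum := by
  induction s generalizing Ψ with
  | zero =>
    simp [rhoMaps, downFrom, slots, freeSlots, cRho, sRho, slotCap, childCount]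
  | succ s ih =>
    rw [sum_permutations'_downFrom_succ, ← ih fun M => (M.map fun i =>
      Ψ ((s + 1) ::ₘ (s + 1) ::ₘ M.erase i)).sum, sum_rhoMaps_succ]
    refine Finset.sum_congr rfl fun ρ _ => ?_
    rw [sum_freeSlots, Finset.mul_sum]
    refine Finset.sum_congr rfl fun j _ => ?_
    rw [cRho_attach]
    by_cases h : slotCap j - childCount ρ j = 0
    · simp [h]
    · rw [freeSlots_attach ρ j h]
      push_cast
      ring

/-! ### Walks -/

/-- The product of the values of `e` on the steps of the walk `a, l, b`. -/
def walkWeight {ι : Type*} (e : ι → ι → ℝ) (a b : ι) : List ι → ℝ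
  | [] => e a b
  | c :: l => e a c * walkWeight e c b l

theorem walkWeight_map {ι κ : Type*} (e : ι → ι → ℝ) (f : κ → ι) (a b : κ) (l : List κ) :
    walkWeight e (f a) (f b) (l.map f) = walkWeight (fun i j => e (f i) (f j)) a b l := by
  induction l generalizing a with
  | nil => rfl
  | cons c l ih => rw [List.map_cons, walkWeight, walkWeight, ih]

/-- The product of the values of `e` on the steps of the closed walk through the entries of `y`. -/
def cycleWeight {ι : Type*} {s : ℕ} (e : ι → ι → ℝ) (y : Fin (s + 1) → ι) : ℝ :=
  ∏ j, e (y j) (y (j + 1))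

theorem walkWeight_ofFn {ι : Type*} {s : ℕ} (e : ι → ι → ℝ) (y : Fin (s + 1) → ι) (b : ι) :
    walkWeight e (y 0) b (List.ofFn (Fin.tail y)) =
      (∏ j : Fin s, e (y j.castSucc) (y j.succ)) * e (y (Fin.last s)) b := by
  induction s with
  | zero => simp [walkWeight]
  | succ s ih =>
    rw [List.ofFn_succ, walkWeight, Fin.prod_univ_succ, mul_assoc]
    have h := ih (Fin.tail y)
    unfold Fin.tail at h ⊢
    exact congrArg (e (y 0) (y 1) * ·) h

theorem cycleWeight_eq_walkWeight {ι : Type*} {s : ℕ} (e : ι → ι → ℝ) (y : Fin (s + 1) → ι) :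
    cycleWeight e y = walkWeight e (y 0) (y 0) (List.ofFn (Fin.tail y)) := by
  rw [walkWeight_ofFn, cycleWeight, Fin.prod_univ_castSucc]
  simp only [Fin.coeSucc_eq_succ, Fin.last_add_one]

theorem cycleWeight_comp_add {ι : Type*} {s : ℕ} (e : ι → ι → ℝ) (y : Fin (s + 1) → ι)
    (c : Fin (s + 1)) : cycleWeight e (fun j => y (j + c)) = cycleWeight e y := by
  simp only [cycleWeight, add_right_comm _ 1 c]
  exact Equiv.prod_comp (Equiv.addRight c) fun j => e (y j) (y (j + 1))

/-- An entry of `(E D) ^ s E`, with `D` diagonal, is a sum over walks with `s` intermediate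
points. -/
theorem mul_diagonal_pow_mul_apply {ι : Type*} [Fintype ι] [DecidableEq ι] (e : ι → ι → ℝ)
    (p : ι → ℝ) (s : ℕ) (a b : ι) :
    ((of e * diagonal p) ^ s * of e) a b =
      ∑ k : Fin s → ι, (∏ j, p (k j)) * walkWeight e a b (List.ofFn k) := by
  induction s generalizing a with
  | zero => simp [walkWeight]
  | succ s ih =>
    rw [pow_succ', Matrix.mul_assoc, mul_apply,
      ← (Fin.consEquiv fun _ : Fin (s + 1) => ι).sum_comp, Fintype.sum_prod_type]
    refine Finset.sum_congr rfl fun c _ => ?_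
    rw [ih, mul_diagonal, of_apply, Finset.mul_sum]
    refine Finset.sum_congr rfl fun k _ => ?_
    simp only [Fin.consEquiv, Equiv.coe_fn_mk, Fin.prod_univ_succ, Fin.cons_zero, Fin.cons_succ,
      List.ofFn_cons, walkWeight]
    ring

/-- The trace of a power of `E D`, with `D` diagonal, is a sum over closed walks. -/
theorem trace_mul_diagonal_pow {ι : Type*} [Fintype ι] [DecidableEq ι] (e : ι → ι → ℝ)
    (p : ι → ℝ) (s : ℕ) :
    ((of e * diagonal p) ^ (s + 1)).trace =
      ∑ y : Fin (s + 1) → ι, (∏ j, p (y j)) * cycleWeight e y := by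
  rw [pow_succ, ← Matrix.mul_assoc, trace,
    ← (Fin.consEquiv fun _ : Fin (s + 1) => ι).sum_comp, Fintype.sum_prod_type]
  refine Finset.sum_congr rfl fun a _ => ?_
  rw [diag_apply, mul_diagonal, mul_diagonal_pow_mul_apply, Finset.sum_mul]
  refine Finset.sum_congr rfl fun k _ => ?_
  rw [cycleWeight_eq_walkWeight]
  simp only [Fin.consEquiv, Equiv.coe_fn_mk, Fin.prod_univ_succ, Fin.cons_zero, Fin.cons_succ,
    Fin.tail_cons]
  ring

/-! ### Sorting the entries of a tuple -/

/-- A monotone tuple `I` can be rearranged into a given tuple `k` in `I!` ways if it is the sorted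
version of `k`, and not at all otherwise. -/
theorem card_filter_comp_eq {n s : ℕ} {I : Fin (s + 1) → Fin n} (hI : Monotone I)
    (k : Fin (s + 1) → Fin n) :
    (Finset.univ.filter fun π : Equiv.Perm (Fin (s + 1)) => I ∘ π = k).card =
      if I = k ∘ Tuple.sort k then multiFactorial I else 0 := by
  split_ifs with h
  · have h1 := DomMulAct.stabilizer_card I
    rw [Fintype.card_subtype] at h1
    simp only [Fintype.card_subtype] at h1
    rw [multiFactorial, ← h1]
    refine Finset.card_bij (fun π _ => π * Tuple.sort k) (fun π hπ => ?_)
      (fun _ _ _ _ h => mul_right_cancel h) fun g hg => ⟨g * (Tuple.sort k)⁻¹, ?_, by simp⟩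
    · simp only [Finset.mem_filter, Finset.mem_univ, true_and] at hπ ⊢
      rw [Equiv.Perm.coe_mul, ← Function.comp_assoc, hπ, h]
    · simp only [Finset.mem_filter, Finset.mem_univ, true_and] at hg ⊢
      rw [Equiv.Perm.coe_mul, ← Function.comp_assoc, hg, h, Function.comp_assoc,
        ← Equiv.Perm.coe_mul, mul_inv_cancel, Equiv.Perm.coe_one, Function.comp_id]
  · rw [Finset.card_eq_zero, Finset.filter_eq_empty_iff]
    rintro π - rfl
    refine h (Tuple.unique_monotone (σ := 1) (τ := π * Tuple.sort (I ∘ π)) ?_ ?_)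
    · simpa using hI
    · rw [Equiv.Perm.coe_mul, ← Function.comp_assoc]
      exact Tuple.monotone_sort _

theorem multiFactorial_ne_zero {n s : ℕ} (I : Fin (s + 1) → Fin n) :
    (multiFactorial I : ℝ) ≠ 0 :=
  Nat.cast_ne_zero.2 (Finset.prod_ne_zero_iff.2 fun _ _ => Nat.factorial_ne_zero _)

/-- A sum over all tuples, grouped by the sorted versions of the tuples. -/
theorem sum_eq_sum_multiIndices {n s : ℕ} (f : (Fin (s + 1) → Fin n) → ℝ) :
    ∑ k, f k = ∑ I ∈ multiIndices n s, (1 / (multiFactorial I : ℝ)) *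
      ∑ π : Equiv.Perm (Fin (s + 1)), f (I ∘ π) := by
  classical
  have h1 : ∀ I ∈ multiIndices n s, (1 / (multiFactorial I : ℝ)) *
      ∑ π : Equiv.Perm (Fin (s + 1)), f (I ∘ π) =
      ∑ k, if I = k ∘ Tuple.sort k then f k else 0 := fun I hI => by
    have hI : Monotone I := by simpa [multiIndices] using hI
    rw [← Finset.sum_fiberwise (g := fun π : Equiv.Perm (Fin (s + 1)) => I ∘ π), Finset.mul_sum]
    refine Finset.sum_congr rfl fun k _ => ?_
    rw [Finset.sum_congr rfl (g := fun _ => f k) fun π hπ => by rw [(Finset.mem_filter.1 hπ).2],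
      Finset.sum_const, card_filter_comp_eq hI]
    split_ifs
    · have := multiFactorial_ne_zero I
      rw [nsmul_eq_mul]
      field_simp
    · simp
  rw [Finset.sum_congr rfl h1, Finset.sum_comm]
  refine Finset.sum_congr rfl fun k _ => ?_
  rw [Finset.sum_ite_eq', if_pos]
  simpa [multiIndices] using Tuple.monotone_sort k

/-! ### Closed walks up to rotation -/

/-- A rotation-invariant sum over all orders of `s + 1` points reduces to the orders that begin
with the point `0`. -/
theorem sum_perm_eq_of_rotation {s : ℕ} (g : Equiv.Perm (Fin (s + 1)) → ℝ)
    (hg : ∀ π c, g (π * Equiv.addRight c) = g π) :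
    ∑ π, g π = (s + 1) * ∑ σ : Equiv.Perm (Fin s), g (Equiv.Perm.decomposeFin.symm (0, σ)) := by
  -- the orders are classified by the place `c` of the point `0`
  have h1 : ∑ π, g π = ∑ c : Fin (s + 1), ∑ π : Equiv.Perm (Fin (s + 1)),
      if π c = 0 then g π else 0 := by
    rw [Finset.sum_comm]
    refine Finset.sum_congr rfl fun π _ => ?_
    simp only [← Equiv.eq_symm_apply]
    simp
  have h2 : ∀ c : Fin (s + 1), (∑ π : Equiv.Perm (Fin (s + 1)), if π c = 0 then g π else 0) =
      ∑ π : Equiv.Perm (Fin (s + 1)), if π 0 = 0 then g π else 0 := fun c => by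
    rw [← Equiv.sum_comp (Equiv.mulRight (Equiv.addRight (-c)))]
    simp [hg]
  rw [h1, Finset.sum_congr rfl fun c _ => h2 c, Finset.sum_const, Finset.card_univ,
    Fintype.card_fin, nsmul_eq_mul, ← Equiv.Perm.decomposeFin.symm.sum_comp,
    Fintype.sum_prod_type]
  push_cast
  congr 1
  rw [Finset.sum_comm]
  refine Finset.sum_congr rfl fun σ _ => ?_
  simp

/-- The permutations of an `s`-element set, listed as the rearrangements of `[s, …, 2, 1]`. -/
theorem sum_perm_eq_sum_permutations' (s : ℕ) (g : List ℕ → ℝ) :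
    ∑ σ : Equiv.Perm (Fin s), g (List.ofFn fun j => (σ j : ℕ) + 1) =
      ((downFrom s).permutations'.map g).sum := by
  set φ : Equiv.Perm (Fin s) → List ℕ := fun σ => List.ofFn fun j => (σ j : ℕ) + 1 with hφ
  have hinj : Function.Injective φ := fun σ τ h => by
    ext j
    simpa using congrFun (List.ofFn_injective h) j
  -- an inclusion suffices, since both multisets have `s!` elements
  have hle : (Finset.univ.val.map φ) ≤ ((downFrom s).permutations' : Multiset (List ℕ)) := by
    rw [Multiset.le_iff_subset (Finset.univ.nodup.map hinj)]
    intro l hl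
    obtain ⟨σ, -, rfl⟩ := Multiset.mem_map.1 hl
    rw [Multiset.mem_coe, List.mem_permutations', List.perm_ext_iff_of_nodup _ (nodup_downFrom s)]
    · intro k
      rw [mem_downFrom, List.mem_ofFn]
      constructor
      · rintro ⟨j, rfl⟩
        have := (σ j).2
        omega
      · rintro ⟨h1, h2⟩
        exact ⟨σ.symm ⟨k - 1, by omega⟩, by simp; omega⟩
    · rw [List.nodup_ofFn]
      intro i j h
      simpa [← Fin.ext_iff] using h
  have heq := Multiset.eq_of_le_of_card_le hle (by
    rw [Multiset.coe_card, ← (List.permutations_perm_permutations' _).length_eq,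
      List.length_permutations, length_downFrom, Multiset.card_map, Finset.card_val,
      Finset.card_univ, Fintype.card_perm, Fintype.card_fin])
  rw [← Multiset.sum_coe, ← Multiset.map_coe, ← heq, Multiset.map_map]
  rfl

/-! ### The weights in terms of slots -/

/-- For a non-increasing sequence `X` one has `|X a - X b| = X a + X b - 2 X (max a b)`, so the
weight of a closed path depends only on its slots. -/
theorem walkWeight_exp {X : ℕ → ℝ} (hX : Antitone X) (a : ℕ) (l : List ℕ) :
    walkWeight (fun i j => Real.exp (-|X i - X j| / 2)) a 0 l =
      Real.exp (-((X a + X 0) / 2 + (l.map X).sum - ((slots a l).map X).sum)) := by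
  have habs : ∀ i j, |X i - X j| = X i + X j - 2 * X (max i j) := fun i j => by
    rcases le_total i j with h | h
    · rw [max_eq_right h, abs_of_nonneg (sub_nonneg.2 (hX h))]
      ring
    · rw [max_eq_left h, abs_of_nonpos (sub_nonpos.2 (hX h))]
      ring
  induction l generalizing a with
  | nil =>
    rw [walkWeight, habs]
    simp [slots]
    ring
  | cons c l ih =>
    rw [walkWeight, ih, ← Real.exp_add, habs]
    simp only [slots, List.map_cons, List.sum_cons, Multiset.map_cons, Multiset.sum_cons]
    ring_nf

theorem sum_map_downFrom (X : ℕ → ℝ) (s : ℕ) :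
    X 0 + ((downFrom s).map X).sum = ∑ j ∈ Finset.range (s + 1), X j := by
  induction s with
  | zero => simp [downFrom]
  | succ s ih =>
    rw [Finset.sum_range_succ, ← ih, downFrom, List.map_cons, List.sum_cons]
    ring

/-- The exponent of a tree depends only on its free slots, because every parent `ρ k` is a slot that
is no longer free. -/
theorem sum_sub_eq_of_cRho_ne_zero {s : ℕ} {ρ : Fin s → Fin s} (h : cRho ρ ≠ 0) (X : ℕ → ℝ) :
    ∑ k, (X (ρ k) - X (k + 1)) =
      ∑ j ∈ Finset.range (s + 1), X j - ((freeSlots ρ).map X).sum := by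
  have hle : ∀ j : Fin (s + 1), childCount ρ j ≤ slotCap j := fun j => by
    rw [cRho_eq_prod] at h
    have := Finset.prod_ne_zero_iff.1 h j (Finset.mem_range.2 j.2)
    by_contra hlt
    exact this (Nat.descFactorial_eq_zero_iff_lt.2 (not_le.1 hlt))
  have h1 : ∑ j : Fin (s + 1), (childCount ρ j : ℝ) * X j = ∑ k, X (ρ k) := by
    have h2 : ∀ j : Fin (s + 1), (childCount ρ j : ℝ) * X j =
        ∑ k, if j = (ρ k).castSucc then X j else 0 := fun j => by
      rw [childCount, ← nsmul_eq_mul, ← Finset.sum_const, Finset.sum_filter]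
      refine Finset.sum_congr rfl fun k _ => if_congr ?_ rfl rfl
      rw [Fin.ext_iff, Fin.val_castSucc, eq_comm]
    rw [Finset.sum_congr rfl fun j _ => h2 j, Finset.sum_comm]
    refine Finset.sum_congr rfl fun k _ => ?_
    rw [Finset.sum_ite_eq' Finset.univ (ρ k).castSucc fun j : Fin (s + 1) => X j,
      if_pos (Finset.mem_univ _), Fin.val_castSucc]
  have h3 : ∀ j : Fin (s + 1), ((slotCap j - childCount ρ j : ℕ) : ℝ) * X j =
      (slotCap j : ℝ) * X j - (childCount ρ j : ℝ) * X j := fun j => by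
    rw [Nat.cast_sub (hle j), sub_mul]
  rw [sum_freeSlots, Finset.sum_range, Finset.sum_congr rfl fun j _ => h3 j,
    Finset.sum_sub_distrib, Finset.sum_sub_distrib, h1, Fin.sum_univ_succ,
    Fin.sum_univ_succ fun j : Fin (s + 1) => (slotCap j : ℝ) * X j]
  simp only [slotCap, Fin.val_zero, Fin.val_succ, if_true, Nat.succ_ne_zero, if_false,
    ← Finset.mul_sum]
  push_cast
  ring

/-- The sum over all orders of a closed walk through `s + 1` points on a line, as a sum over
increasing trees. -/
theorem sum_perm_cycleWeight {s : ℕ} {X : ℕ → ℝ} (hX : Antitone X) :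
    ∑ π : Equiv.Perm (Fin (s + 1)),
      cycleWeight (fun i j : Fin (s + 1) => Real.exp (-|X i - X j| / 2)) π =
    (s + 1) * ∑ ρ ∈ rhoMaps s, (cRho ρ : ℝ) * Real.exp (-∑ k, (X (ρ k) - X (k + 1))) := by
  set e := fun i j : ℕ => Real.exp (-|X i - X j| / 2) with he
  rw [sum_perm_eq_of_rotation _ fun π c =>
    cycleWeight_comp_add (fun i j : Fin (s + 1) => e i j) π c]
  congr 1
  -- the common weight of walks and trees with the free slots `M`
  set Ψ : Multiset ℕ → ℝ := fun M =>
    Real.exp (-(∑ j ∈ Finset.range (s + 1), X j - (M.map X).sum)) with hΨ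
  have h1 : ∀ σ : Equiv.Perm (Fin s), cycleWeight (fun i j : Fin (s + 1) => e i j)
      (Equiv.Perm.decomposeFin.symm (0, σ)) =
      walkWeight e 0 0 (List.ofFn fun j => (σ j : ℕ) + 1) := fun σ => by
    have h := walkWeight_map e (fun j : Fin (s + 1) => (j : ℕ)) 0 0
      (List.ofFn fun j => (σ j).succ)
    have ht : Fin.tail ⇑(Equiv.Perm.decomposeFin.symm (0, σ)) = fun j => (σ j).succ := by
      funext j
      rw [Fin.tail, Equiv.Perm.decomposeFin_symm_apply_succ, Equiv.swap_self, Equiv.refl_apply]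
    rw [cycleWeight_eq_walkWeight, Equiv.Perm.decomposeFin_symm_apply_zero, ht, ← h, List.map_ofFn]
    rfl
  have h2 : ∀ l ∈ (downFrom s).permutations', walkWeight e 0 0 l = Ψ (slots 0 l) := fun l hl => by
    rw [walkWeight_exp hX, hΨ, ← sum_map_downFrom,
      ((List.mem_permutations'.1 hl).map X).sum_eq]
    ring_nf
  rw [Finset.sum_congr rfl fun σ _ => h1 σ, sum_perm_eq_sum_permutations',
    List.map_congr_left h2, ← sum_cRho_mul_freeSlots]
  refine Finset.sum_congr rfl fun ρ _ => ?_
  by_cases hρ : cRho ρ = 0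
  · simp [hρ]
  · rw [sum_sub_eq_of_cRho_ne_zero hρ]

/-- The normalized traces of the powers of the Lax matrix are given by the explicit formula. -/
theorem traceIntegral_eq_explicitIntegral {n : ℕ} (s : ℕ) {x : Phase n} (hx : x ∈ region n) :
    traceIntegral s x = explicitIntegral s x := by
  have hanti : Antitone x.1 := fun i j hij => by
    rcases hij.eq_or_lt with rfl | h
    exacts [le_rfl, (hx i j h).le]
  rw [traceIntegral, laxMatrix, kernelMatrix, trace_mul_diagonal_pow, sum_eq_sum_multiIndices,
    explicitIntegral, Finset.sum_div]
  refine Finset.sum_congr rfl fun I hI => ?_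
  have hI : Monotone I := by simpa [multiIndices] using hI
  -- the positions of the chosen peakons, continued to a non-increasing sequence
  set X : ℕ → ℝ := fun a => x.1 (I ⟨min a s, by omega⟩) with hXdef
  have hX : Antitone X := fun a b hab =>
    hanti (hI (Fin.mk_le_mk.2 (min_le_min_right s hab)))
  have hXv : ∀ j : Fin (s + 1), X j = x.1 (I j) := fun j => by
    simp only [hXdef, min_eq_left (Nat.lt_succ_iff.1 j.2)]
  have h1 : ∀ π : Equiv.Perm (Fin (s + 1)),
      (∏ j, x.2 ((I ∘ π) j)) * cycleWeight (halfExp x) (I ∘ π) = (∏ j, x.2 (I j)) *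
        cycleWeight (fun i j : Fin (s + 1) => Real.exp (-|X i - X j| / 2)) π := fun π => by
    congr 1
    · exact Equiv.prod_comp π fun j => x.2 (I j)
    · simp only [cycleWeight, Function.comp_apply, halfExp_eq hx, hXv]
  have hs : (s : ℝ) + 1 ≠ 0 := by positivity
  rw [Finset.sum_congr rfl fun π _ => h1 π, ← Finset.mul_sum, sum_perm_cycleWeight hX]
  have h2 : ∀ (ρ : Fin s → Fin s) (k : Fin s), X (ρ k) - X (k + 1) =
      x.1 (I (ρ k).castSucc) - x.1 (I k.succ) := fun ρ k => by
    rw [← hXv, ← hXv, Fin.val_castSucc, Fin.val_succ]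
  simp only [h2]
  field_simp

/-- Counted with the coefficients `c_ρ`, the trees are as many as the closed paths that start at `0`
and visit `1, …, s` once, namely `s!`. -/
theorem sum_cRho (s : ℕ) : ∑ ρ ∈ rhoMaps s, cRho ρ = Nat.factorial s := by
  have h1 := sum_perm_eq_sum_permutations' s fun _ => 1
  have h2 := sum_cRho_mul_freeSlots s fun _ => 1
  rw [← h1] at h2
  simp only [mul_one, Finset.sum_const, Finset.card_univ, Fintype.card_perm, Fintype.card_fin,
    nsmul_eq_mul] at h2
  exact_mod_cast h2

end Peakon

end


theorem mainTheorem5 (n : ℕ) :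
    (∃ H : ℕ → Peakon.Phase n → ℝ, Peakon.IsRecursionSequence n H) ∧
    (∀ H : ℕ → Peakon.Phase n → ℝ, Peakon.IsRecursionSequence n H →
      ∀ s : ℕ, Peakon.IsFirstIntegral (H s) ∧
        ∀ x ∈ Peakon.region n, H s x = Peakon.explicitIntegral s x) ∧
    (∀ s : ℕ, ∑ ρ ∈ Peakon.rhoMaps s, Peakon.cRho ρ = Nat.factorial s) :=
  ⟨⟨Peakon.traceIntegral, Peakon.isRecursionSequence_traceIntegral n⟩,
    fun _ hH s => ⟨Peakon.isFirstIntegral_of_eq_traceIntegral s fun _ hx =>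
      hH.eq_traceIntegral s hx, fun _ hx =>
      (hH.eq_traceIntegral s hx).trans (Peakon.traceIntegral_eq_explicitIntegral s hx)⟩,
    Peakon.sum_cRho⟩
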